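/- **Setting.** There are $n=3f+1$ parties in an asynchronous network with reliable authenticated channels; at most $f$ of them are Byzantine (arbitrary behaviour), the others are honest. Delays and the order of events are arbitrary, but messages between honest parties are delivered eventually and an honest party eventually carries out every step its code allows. Here $f=f(k)$ is bounded by a polynomial in the security parameter $k$. A function of $k$ is negligible if it decreases faster than every inverse polynomial. **Protocol (Slim-HBBFT).** Every honest party joins the committee selection, which returns a committee $C$ to it. A party in $C$ that has an input (its encrypted request $v$) broadcasts it by Prioritized Provable Broadcast (P-PB); when P-PB returns a proof $\sigma$, it sends the proposal $(v,\sigma)$ to all parties. A party *holds* a proposal of $j\in C$ if it has received it with a valid proof, in a message of any kind. Every party that holds a proposal suggests one such proposal to all parties. For each $j\in C$ it inputs one bit to the asynchronous binary agreement (ABA) instance of $j$: it inputs $1$ if it holds a proposal of $j$; it inputs $0$ if it has received valid suggestions from $n-f$ parties and holds no proposal of $j$. When the ABA instances of all members of $C$ have returned, it sends to all parties the proposals it holds of accepted members (those whose ABA instance returned $1$), and as soon as it holds a proposal of every accepted member it outputs the set of pairs $(j,v)$, $j$ accepted and $v$ the request of $j$. **Security of the subprotocols.** In the executions of the protocol with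 the given adversary, each of the following fails with at most negligible probability. *Committee selection.* If $f+1$ honest parties participate, every participating honest party obtains a committee; honest parties obtain the same committee; it has $f+1$ members. *P-PB*, for the instance of each sender $j$ (where $j=j(k)$ is any choice of a party for each $k$). If $j$ is honest, starts the broadcast, and is in the committee of every honest party, it obtains a proof; the proof obtained by an honest sender is valid for its request. An honest party accepts at most one request from $j$, only if $j$ is in its committee, and, if $j$ is honest, only a request that $j$ broadcast. If a request with a valid proof reaches an honest party, then $f+1$ honest parties have accepted that request, and no valid proof for another request of $j$ reaches an honest party. *ABA*, for the instance of each $j=j(k)$. If all honest parties input a bit, all honest parties obtain an output; honest outputs are equal; an honest party outputs $b$ only if some honest party input $b$; and if $f+1$ honest parties input $1$, no honest party outputs $0$. **Theorem.** Under these assumptions, except with negligible probability, Slim-HBBFT satisfies all of the following properties of an Asynchronous Common Subset protocol. *Agreement.* If an honest party outputs $O$, then every honest party outputs $O$, and nothing else. *Validity.* If an honest party outputs $O$, then there is a committee $C$ of $f+1$ parties, at least one of them honest, which every honest party obtained from the committee selection, and $O$ consists of one request from each of $q$ members of $C$, where $1\le q\le f+1$. Every request in $O$ has a valid P-PB proof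 and was accepted by at least $f+1$ honest parties in the P-PB instance of its owner; if its owner is honest, it is an input of its owner. *Totality.* If $n-f$ honest parties receive an input, then every honest party outputs. -/

import Mathlib

open MeasureTheory Filter Asymptotics

namespace SlimHBBFT

/-- The `n = 3f+1` parties. -/
abbrev Party (f : ℕ) : Type := Fin (3 * f + 1)

/-- A proposal: the (encrypted) request of a committee member, with the proof that the
prioritized provable broadcast (P-PB) of this member returned for it. -/
structure Proposal (f : ℕ) (V S : Type*) where
  owner : Party f
  request : V
  proof : S

/-- The messages of the propose step, of the suggest step and of the final reveal step. -/
inductive Msg (f : ℕ) (V S : Type*)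
  | propose (x : Proposal f V S)
  | suggest (x : Proposal f V S)
  | reveal (x : Proposal f V S)

/-- The proposal that a message carries. -/
def Msg.content {f : ℕ} {V S : Type*} : Msg f V S → Proposal f V S
  | .propose x => x
  | .suggest x => x
  | .reveal x => x

/-- The events of an execution. The subprotocols are visible through their interfaces.
* `input p v`: the clients hand the request `v` to `p`;
* `csInvoke p`, `csOutput p C`: `p` joins the committee selection, which returns `C` to `p`;
* `ppbInput p v`: `p` starts, as a sender, its P-PB instance with the request `v`;
* `ppbDeliver p j v`: `p` accepts (signs) the request `v` in the P-PB instance of `j`;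
* `ppbProof p σ`: the P-PB instance of `p` returns the proof `σ` to the sender `p`;
* `send p m`: `p` sends `m` to all parties; `receive p q m`: `p` receives `m` from `q`;
* `abaInput p j b`, `abaOutput p j b`: `p` inputs `b` to, or is returned `b` by, the
  binary agreement instance of the committee member `j`;
* `output p O`: `p` outputs the common subset `O`; `O j = some v` means that the request `v`
  of `j` belongs to it, `O j = none` that no request of `j` does;
* `internal`: anything else (for example an internal step of a subprotocol). -/
inductive Event (f : ℕ) (V S : Type*)
  | input (p : Party f) (v : V)
  | csInvoke (p : Party f)
  | csOutput (p : Party f) (C : Finset (Party f))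
  | ppbInput (p : Party f) (v : V)
  | ppbDeliver (p j : Party f) (v : V)
  | ppbProof (p : Party f) (σ : S)
  | send (p : Party f) (m : Msg f V S)
  | receive (p q : Party f) (m : Msg f V S)
  | abaInput (p j : Party f) (b : Bool)
  | abaOutput (p j : Party f) (b : Bool)
  | output (p : Party f) (O : Party f → Option V)
  | internal

/-- The tasks that the code of a party consists of; each is carried out at most once. -/
inductive Task (f : ℕ)
  | selectCommittee
  | broadcast
  | propose
  | suggest
  | vote (j : Party f)
  | reveal (j : Party f)
  | output

/-- The party and the task to which an event belongs; `none` for the events that are not under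
the control of the code of a party (client inputs, message receptions, returns of
subprotocols). -/
def Event.task {f : ℕ} {V S : Type*} : Event f V S → Option (Party f × Task f)
  | .csInvoke p => some (p, .selectCommittee)
  | .ppbInput p _ => some (p, .broadcast)
  | .send p (.propose _) => some (p, .propose)
  | .send p (.suggest _) => some (p, .suggest)
  | .send p (.reveal x) => some (p, .reveal x.owner)
  | .abaInput p j _ => some (p, .vote j)
  | .output p _ => some (p, .output)
  | _ => none

/-- One execution: the set of Byzantine parties, the public predicate that checks P-PB proofs
(it depends on the keys), and the sequence of events. -/
structure Execution (f : ℕ) (V S : Type*) where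
  byz : Finset (Party f)
  verify : Proposal f V S → Prop
  event : ℕ → Event f V S

namespace Execution

variable {f : ℕ} {V S : Type*} (X : Execution f V S)

def Honest (p : Party f) : Prop := p ∉ X.byz

/-- `e` happens strictly before time `t`. -/
def Before (t : ℕ) (e : Event f V S) : Prop := ∃ s < t, X.event s = e

/-- `e` happens at some time. -/
def Occurs (e : Event f V S) : Prop := ∃ s, X.event s = e

/-- Before time `t`, the committee selection has returned to `p` a committee containing `j`. -/
def Selected (t : ℕ) (p j : Party f) : Prop :=
  ∃ C, X.Before t (.csOutput p C) ∧ j ∈ C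

/-- At time `t`, `p` has received, in a message of any kind, the proposal `x`; the proof of `x`
is valid and its owner is a committee member. -/
def Holds (t : ℕ) (p : Party f) (x : Proposal f V S) : Prop :=
  X.verify x ∧ X.Selected t p x.owner ∧
    ∃ q m, X.Before t (.receive p q m) ∧ m.content = x

/-- At time `t`, `p` has received valid suggestions from `n - f = 2f+1` distinct parties. -/
def EnoughSuggestions (t : ℕ) (p : Party f) : Prop :=
  ∃ Q : Finset (Party f), 2 * f + 1 ≤ Q.card ∧
    ∀ q ∈ Q, ∃ x, X.verify x ∧ X.Selected t p x.owner ∧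
      X.Before t (.receive p q (.suggest x))

/-- At time `t`, the binary agreement instances of all committee members have returned a bit
to `p`. -/
def Decided (t : ℕ) (p : Party f) : Prop :=
  ∃ C, X.Before t (.csOutput p C) ∧ ∀ j ∈ C, ∃ b, X.Before t (.abaOutput p j b)

/-- The code of Slim-HBBFT: `X.Enabled t e` says that the code allows the event `e` at time `t`.
* Every party joins the committee selection.
* A committee member with a request broadcasts it by P-PB.
* When P-PB has returned a proof, the member sends the request with the proof to all parties.
* A party suggests to all parties one proposal that it holds.
* A party inputs `1` to the agreement instance of `j` if it holds a proposal of `j`; it inputs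
  `0` if it has suggestions from `n - f` parties and holds no proposal of `j`.
* When all agreement instances have returned, a party sends to all parties the accepted proposals
  that it holds, and it outputs the requests of the accepted members as soon as it holds them. -/
def Enabled (t : ℕ) : Event f V S → Prop
  | .csInvoke p => ¬ X.Before t (.csInvoke p)
  | .ppbInput p v =>
      X.Before t (.input p v) ∧ X.Selected t p p ∧ ∀ w, ¬ X.Before t (.ppbInput p w)
  | .send p (.propose x) =>
      x.owner = p ∧ X.Before t (.ppbInput p x.request) ∧ X.Before t (.ppbProof p x.proof) ∧
        ∀ y, ¬ X.Before t (.send p (.propose y))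
  | .send p (.suggest x) =>
      X.Holds t p x ∧ ∀ y, ¬ X.Before t (.send p (.suggest y))
  | .send p (.reveal x) =>
      X.Holds t p x ∧ X.Decided t p ∧ X.Before t (.abaOutput p x.owner true) ∧
        ∀ y, y.owner = x.owner → ¬ X.Before t (.send p (.reveal y))
  | .abaInput p j true =>
      (∃ x, X.Holds t p x ∧ x.owner = j) ∧ ∀ b, ¬ X.Before t (.abaInput p j b)
  | .abaInput p j false =>
      X.Selected t p j ∧ X.EnoughSuggestions t p ∧ (¬ ∃ x, X.Holds t p x ∧ x.owner = j) ∧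
        ∀ b, ¬ X.Before t (.abaInput p j b)
  | .output p O =>
      X.Decided t p ∧
        (∀ j, (∃ v, O j = some v) ↔ X.Selected t p j ∧ X.Before t (.abaOutput p j true)) ∧
        (∀ j v, O j = some v → ∃ σ, X.Holds t p ⟨j, v, σ⟩) ∧
        ∀ O', ¬ X.Before t (.output p O')
  | _ => True

/-- `X` is an execution of Slim-HBBFT in an asynchronous network with authenticated reliable
channels and at most `f` Byzantine parties, whose behaviour is arbitrary. The order of events
and all delays are arbitrary, but a message between honest parties is delivered eventually and
an honest party carries out eventually each task that its code allows. -/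
structure IsSlimHBBFT : Prop where
  card_byz : X.byz.card ≤ f
  safe : ∀ t p τ, X.Honest p → (X.event t).task = some (p, τ) → X.Enabled t (X.event t)
  fair : ∀ t p τ e, X.Honest p → e.task = some (p, τ) → X.Enabled t e →
    ∃ s ≥ t, (X.event s).task = some (p, τ)
  authentic : ∀ t p q m, X.Honest p → X.Honest q → X.event t = .receive p q m →
    X.Before t (.send q m)
  reliable : ∀ t p q m, X.Honest p → X.Honest q → X.event t = .send q m →
    ∃ s > t, X.event s = .receive p q m

/-! ### Security properties of the subprotocols -/

/-- Committee selection: termination, agreement and validity. -/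
structure CSGood : Prop where
  termination : ∀ A : Finset (Party f), f + 1 ≤ A.card →
    (∀ p ∈ A, X.Honest p ∧ X.Occurs (.csInvoke p)) →
      ∀ p, X.Honest p → X.Occurs (.csInvoke p) → ∃ C, X.Occurs (.csOutput p C)
  agreement : ∀ p q C D, X.Honest p → X.Honest q →
    X.Occurs (.csOutput p C) → X.Occurs (.csOutput q D) → C = D
  validity : ∀ p C, X.Honest p → X.Occurs (.csOutput p C) → C.card = f + 1

/-- The P-PB instance with sender `j`.
Termination and correctness concern an honest sender. Integrity: an honest party
accepts at most one request, and from an honest sender only the one that was broadcast.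
Provability: when a valid proof for a request reaches an honest party, `f+1` honest parties have
accepted this request, and no valid proof for another request reaches an honest party.
Prioritization: an honest party accepts requests of committee members only. -/
structure PPBGood (j : Party f) : Prop where
  termination : ∀ v, X.Honest j → X.Occurs (.ppbInput j v) →
    (∀ p, X.Honest p → ∃ t, X.Selected t p j) → ∃ σ, X.Occurs (.ppbProof j σ)
  correctness : ∀ v σ, X.Honest j → X.Occurs (.ppbInput j v) → X.Occurs (.ppbProof j σ) →
    X.verify ⟨j, v, σ⟩
  integrity : ∀ p v w, X.Honest p → X.Occurs (.ppbDeliver p j v) →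
    X.Occurs (.ppbDeliver p j w) → v = w
  authenticity : ∀ t p v, X.Honest p → X.Honest j → X.event t = .ppbDeliver p j v →
    X.Before t (.ppbInput j v)
  provability : ∀ t p q m v σ, X.Honest p → X.event t = .receive p q m →
    m.content = ⟨j, v, σ⟩ → X.verify ⟨j, v, σ⟩ →
      ∃ D : Finset (Party f), f + 1 ≤ D.card ∧
        ∀ d ∈ D, X.Honest d ∧ X.Before t (.ppbDeliver d j v)
  uniqueness : ∀ p q m v σ p' q' m' v' σ', X.Honest p → X.Honest p' →
    X.Occurs (.receive p q m) → m.content = ⟨j, v, σ⟩ → X.verify ⟨j, v, σ⟩ →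
    X.Occurs (.receive p' q' m') → m'.content = ⟨j, v', σ'⟩ → X.verify ⟨j, v', σ'⟩ → v = v'
  prioritization : ∀ t p v, X.Honest p → X.event t = .ppbDeliver p j v → X.Selected t p j

/-- The asynchronous binary agreement instance of `j`. Besides agreement, validity and
termination it is biased towards `1`: if `f+1` honest parties input `1`, the result is `1`. -/
structure ABAGood (j : Party f) : Prop where
  termination : (∀ p, X.Honest p → ∃ b, X.Occurs (.abaInput p j b)) →
    ∀ p, X.Honest p → ∃ b, X.Occurs (.abaOutput p j b)
  agreement : ∀ p q b c, X.Honest p → X.Honest q →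
    X.Occurs (.abaOutput p j b) → X.Occurs (.abaOutput q j c) → b = c
  validity : ∀ p b, X.Honest p → X.Occurs (.abaOutput p j b) →
    ∃ q, X.Honest q ∧ X.Occurs (.abaInput q j b)
  bias : ∀ A : Finset (Party f), f + 1 ≤ A.card →
    (∀ p ∈ A, X.Honest p ∧ X.Occurs (.abaInput p j true)) →
      ∀ p b, X.Honest p → X.Occurs (.abaOutput p j b) → b = true

/-! ### The properties of an asynchronous common subset protocol -/

/-- All honest outputs are equal, and if an honest party outputs, all honest parties do. -/
def Agreement : Prop :=
  ∀ p O, X.Honest p → X.Occurs (.output p O) → ∀ q, X.Honest q →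
    X.Occurs (.output q O) ∧ ∀ O', X.Occurs (.output q O') → O' = O

/-- If an honest party outputs `O`, then `O` consists of requests of `q` members of the selected
committee, `1 ≤ q ≤ f+1`; the committee is the one returned to all honest parties, it has `f+1`
members, and one of them at least is honest. Every request in `O` has a valid proof and was
accepted by `f+1` honest parties in the P-PB instance of its owner, and it is an input
of its owner if the owner is honest. -/
def Validity : Prop :=
  ∀ p O, X.Honest p → X.Occurs (.output p O) →
    ∃ C : Finset (Party f), C.card = f + 1 ∧ (∃ j ∈ C, X.Honest j) ∧
      (∀ q, X.Honest q → X.Occurs (.csOutput q C)) ∧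
      (∀ j v, O j = some v → j ∈ C) ∧
      1 ≤ {j | ∃ v, O j = some v}.ncard ∧ {j | ∃ v, O j = some v}.ncard ≤ f + 1 ∧
      ∀ j v, O j = some v →
        (∃ σ, X.verify ⟨j, v, σ⟩) ∧
        (∃ D : Finset (Party f), f + 1 ≤ D.card ∧
          ∀ d ∈ D, X.Honest d ∧ X.Occurs (.ppbDeliver d j v)) ∧
        (X.Honest j → X.Occurs (.input j v))

/-- If `n - f = 2f+1` honest parties receive an input, all honest parties output. -/
def Totality : Prop :=
  ∀ A : Finset (Party f), 2 * f + 1 ≤ A.card →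
    (∀ p ∈ A, X.Honest p ∧ ∃ v, X.Occurs (.input p v)) →
      ∀ p, X.Honest p → ∃ O, X.Occurs (.output p O)

end Execution

/-- Negligible functions of the security parameter. -/
def Negligible (ε : ℕ → ℝ) : Prop :=
  SuperpolynomialDecay atTop (fun k : ℕ => (k : ℝ)) ε

end SlimHBBFT

/-! Probability enters only at the end: an execution in which all subprotocols behave well has the
three properties deterministically, and a union bound over the P-PB and ABA instances controls the
rest.

In a good execution everything starts from one proposal held by one honest party. That party
suggests, so every honest party comes to hold a proposal and suggests too (`forall_exists_suggest`).
Hence all receive `2f+1` suggestions, vote in every ABA instance of the committee and see it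
decided. An accepted member got a `1` from an honest party, which held a proposal of this member and
reveals one, so everyone can output (`exists_holds_of_accepted`, `exists_output`). For totality, the
initial proposal exists because `2f+1` parties with inputs meet the committee; for agreement, it is
recovered from the given output through an honest vote. Outputs coincide by ABA agreement and P-PB
uniqueness.

The delicate point is that some member is accepted (`exists_accepted`). At its first vote `0` an
honest party already holds the proposals of `2f+1` suggesters, so it rejects the suggestions of at
most `f` honest parties (`card_rejected_le`). By averaging, some honest suggestion has an owner
rejected by at most `f` honest parties; at least `f+1` others vote `1`, and the bias of ABA decides
`1`. -/

namespace SlimHBBFT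

/-! ### Recovering an event from its task -/

section Tasks

variable {f : ℕ} {V S : Type*} {e : Event f V S} {p j : Party f}

lemma Event.eq_of_task_selectCommittee (h : e.task = some (p, .selectCommittee)) :
    e = .csInvoke p := by
  rcases e with _ | _ | _ | _ | _ | _ | ⟨_, _ | _ | _⟩ | _ | _ | _ | _ | _ <;>
    simp_all [Event.task]

lemma Event.eq_of_task_broadcast (h : e.task = some (p, .broadcast)) :
    ∃ v, e = .ppbInput p v := by
  rcases e with _ | _ | _ | _ | _ | _ | ⟨_, _ | _ | _⟩ | _ | _ | _ | _ | _ <;>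
    simp_all [Event.task]

lemma Event.eq_of_task_propose (h : e.task = some (p, .propose)) :
    ∃ x, e = .send p (.propose x) := by
  rcases e with _ | _ | _ | _ | _ | _ | ⟨_, _ | _ | _⟩ | _ | _ | _ | _ | _ <;>
    simp_all [Event.task]

lemma Event.eq_of_task_suggest (h : e.task = some (p, .suggest)) :
    ∃ x, e = .send p (.suggest x) := by
  rcases e with _ | _ | _ | _ | _ | _ | ⟨_, _ | _ | _⟩ | _ | _ | _ | _ | _ <;>
    simp_all [Event.task]

lemma Event.eq_of_task_vote (h : e.task = some (p, .vote j)) :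
    ∃ b, e = .abaInput p j b := by
  rcases e with _ | _ | _ | _ | _ | _ | ⟨_, _ | _ | _⟩ | _ | _ | _ | _ | _ <;>
    simp_all [Event.task]

lemma Event.eq_of_task_reveal (h : e.task = some (p, .reveal j)) :
    ∃ x, x.owner = j ∧ e = .send p (.reveal x) := by
  rcases e with _ | _ | _ | _ | _ | _ | ⟨_, _ | _ | _⟩ | _ | _ | _ | _ | _ <;>
    simp_all [Event.task]

lemma Event.eq_of_task_output (h : e.task = some (p, .output)) :
    ∃ O, e = .output p O := by
  rcases e with _ | _ | _ | _ | _ | _ | ⟨_, _ | _ | _⟩ | _ | _ | _ | _ | _ <;>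
    simp_all [Event.task]

end Tasks

/-! ### Finiteness and double counting -/

/-- Finitely many properties that persist once they hold, and that hold eventually, hold
simultaneously at some time. -/
lemma exists_time_forall {ι : Type*} (s : Finset ι) {R : ℕ → ι → Prop}
    (mono : ∀ i t u, t ≤ u → R t i → R u i) (h : ∀ i ∈ s, ∃ t, R t i) :
    ∃ t, ∀ i ∈ s, R t i := by
  have : ∀ᶠ t in atTop, ∀ i ∈ s, R t i := by
    rw [Filter.eventually_all_finset]
    intro i hi
    obtain ⟨t, ht⟩ := h i hi
    exact eventually_atTop.2 ⟨t, fun u hu => mono i t u hu ht⟩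
  exact this.exists

/-- If a relation on a nonempty finite set relates every element to at most `d` elements, then
at most `d` elements are related to some element. -/
lemma exists_card_preimage_le {α : Type*} (s : Finset α) (hs : s.Nonempty) (d : ℕ)
    (R : α → α → Prop) [DecidableRel R] (h : ∀ a ∈ s, (s.filter (R a)).card ≤ d) :
    ∃ b ∈ s, (s.filter (R · b)).card ≤ d := by
  by_contra! hcon
  -- Counting related pairs by columns gives at least `(d + 1)|s|`, by rows at most `d|s|`.
  have h1 : s.card * (d + 1) ≤ ∑ b ∈ s, (s.filter (R · b)).card := by
    simpa using Finset.card_nsmul_le_sum s _ (d + 1) fun b hb => hcon b hb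
  have h2 : ∑ a ∈ s, (s.filter (R a)).card ≤ s.card * d := by
    simpa using Finset.sum_le_card_nsmul s _ d h
  have h3 : ∑ a ∈ s, (s.filter (R a)).card = ∑ b ∈ s, (s.filter (R · b)).card :=
    Finset.sum_card_bipartiteAbove_eq_sum_card_bipartiteBelow R
  have := hs.card_pos
  nlinarith

/-! ### Persistence in time and the common committee -/

namespace Execution

variable {f : ℕ} {V S : Type*} {X : Execution f V S} {s t : ℕ} {e : Event f V S}
  {p q j : Party f} {x : Proposal f V S} {m : Msg f V S} {C : Finset (Party f)}
  {O : Party f → Option V}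

lemma Before.mono (h : X.Before s e) (hst : s ≤ t) : X.Before t e :=
  let ⟨u, hu, he⟩ := h
  ⟨u, hu.trans_le hst, he⟩

lemma Before.occurs (h : X.Before t e) : X.Occurs e :=
  let ⟨u, _, he⟩ := h
  ⟨u, he⟩

lemma Occurs.exists_before (h : X.Occurs e) : ∃ t, X.Before t e :=
  let ⟨u, he⟩ := h
  ⟨u + 1, u, u.lt_succ_self, he⟩

lemma Selected.mono (h : X.Selected s p j) (hst : s ≤ t) : X.Selected t p j :=
  let ⟨C, hC, hj⟩ := h
  ⟨C, hC.mono hst, hj⟩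

lemma Holds.mono (h : X.Holds s p x) (hst : s ≤ t) : X.Holds t p x :=
  let ⟨hv, hsel, q, m, hr, hm⟩ := h
  ⟨hv, hsel.mono hst, q, m, hr.mono hst, hm⟩

lemma EnoughSuggestions.mono (h : X.EnoughSuggestions s p) (hst : s ≤ t) :
    X.EnoughSuggestions t p :=
  let ⟨Q, hQ, h⟩ := h
  ⟨Q, hQ, fun q hq =>
    let ⟨x, hv, hsel, hr⟩ := h q hq
    ⟨x, hv, hsel.mono hst, hr.mono hst⟩⟩

lemma Decided.mono (h : X.Decided s p) (hst : s ≤ t) : X.Decided t p :=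
  let ⟨C, hC, h⟩ := h
  ⟨C, hC.mono hst, fun j hj =>
    let ⟨b, hb⟩ := h j hj
    ⟨b, hb.mono hst⟩⟩

/-- All honest parties obtain the committee `C`, and no other. -/
structure IsCommittee (X : Execution f V S) (C : Finset (Party f)) : Prop where
  card : C.card = f + 1
  obtained : ∀ p, X.Honest p → X.Occurs (.csOutput p C)
  eq : ∀ p D, X.Honest p → X.Occurs (.csOutput p D) → D = C

lemma IsCommittee.mem (hC : X.IsCommittee C) (hp : X.Honest p) (h : X.Selected t p j) :
    j ∈ C := by
  obtain ⟨D, hD, hj⟩ := h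
  exact hC.eq p D hp hD.occurs ▸ hj

lemma IsCommittee.exists_selected (hC : X.IsCommittee C) (hp : X.Honest p) (hj : j ∈ C) :
    ∃ t, X.Selected t p j :=
  let ⟨t, ht⟩ := (hC.obtained p hp).exists_before
  ⟨t, C, ht, hj⟩

lemma IsCommittee.decided (hC : X.IsCommittee C) (hp : X.Honest p) (h : X.Decided t p)
    (hj : j ∈ C) : X.Selected t p j ∧ ∃ b, X.Before t (.abaOutput p j b) := by
  obtain ⟨D, hD, h⟩ := h
  obtain rfl := hC.eq p D hp hD.occurs
  exact ⟨⟨D, hD, hj⟩, h j hj⟩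

/-! ### Spreading of proposals, suggestions and votes -/

namespace IsSlimHBBFT

lemma le_card_honest (hX : X.IsSlimHBBFT) : 2 * f + 1 ≤ X.byzᶜ.card := by
  have := hX.card_byz
  rw [Finset.card_compl, Fintype.card_fin]
  omega

lemma exists_honest_mem (hX : X.IsSlimHBBFT) {A : Finset (Party f)} (hA : f + 1 ≤ A.card) :
    ∃ j ∈ A, X.Honest j :=
  Finset.exists_mem_notMem_of_card_lt_card (hX.card_byz.trans_lt hA)

lemma occurs_csInvoke (hX : X.IsSlimHBBFT) (hp : X.Honest p) : X.Occurs (.csInvoke p) := by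
  obtain ⟨s, -, hs⟩ := hX.fair 0 p .selectCommittee (.csInvoke p) hp rfl
    fun ⟨_, h, _⟩ => absurd h (Nat.not_lt_zero _)
  exact ⟨s, Event.eq_of_task_selectCommittee hs⟩

lemma exists_isCommittee (hX : X.IsSlimHBBFT) (hCS : X.CSGood) : ∃ C, X.IsCommittee C := by
  have hout : ∀ p, X.Honest p → ∃ C, X.Occurs (.csOutput p C) := fun p hp =>
    hCS.termination X.byzᶜ (by have := hX.le_card_honest; omega)
      (fun q hq => ⟨Finset.mem_compl.1 hq, hX.occurs_csInvoke (Finset.mem_compl.1 hq)⟩)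
      p hp (hX.occurs_csInvoke hp)
  obtain ⟨p, hp⟩ : X.byzᶜ.Nonempty :=
    Finset.card_pos.1 (by have := hX.le_card_honest; omega)
  have hp := Finset.mem_compl.1 hp
  obtain ⟨C, hC⟩ := hout p hp
  have heq : ∀ q D, X.Honest q → X.Occurs (.csOutput q D) → D = C := fun q D hq hD =>
    hCS.agreement q p D C hq hp hD hC
  refine ⟨C, hCS.validity p C hp hC, fun q hq => ?_, heq⟩
  obtain ⟨D, hD⟩ := hout q hq
  exact heq q D hq hD ▸ hD

/-- The message may arrive before the committee is known to the receiver, so the proposal counts as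
held only from the later of the two times. -/
lemma exists_holds_of_send (hX : X.IsSlimHBBFT) (hC : X.IsCommittee C) (hp : X.Honest p)
    (hq : X.Honest q) (hs : X.Occurs (.send p m)) (hv : X.verify m.content)
    (hm : m.content.owner ∈ C) : ∃ t, X.Holds t q m.content := by
  obtain ⟨t, ht⟩ := hs
  obtain ⟨u, -, hu⟩ := hX.reliable t q p m hq hp ht
  obtain ⟨w, hw⟩ := hC.exists_selected hq hm
  exact ⟨max w (u + 1), hv, hw.mono (le_max_left _ _), p, m,
    ⟨u, by omega, hu⟩, rfl⟩

lemma holds_of_suggest (hX : X.IsSlimHBBFT) (hp : X.Honest p)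
    (h : X.event t = .send p (.suggest x)) : X.Holds t p x := by
  have := hX.safe t p .suggest hp (by rw [h]; rfl)
  rw [h] at this
  exact this.1

lemma suggest_unique (hX : X.IsSlimHBBFT) (hp : X.Honest p) {y : Proposal f V S}
    (hx : X.Occurs (.send p (.suggest x))) (hy : X.Occurs (.send p (.suggest y))) : x = y := by
  obtain ⟨s, hs⟩ := hx
  obtain ⟨t, ht⟩ := hy
  have h₁ := hX.safe s p .suggest hp (by rw [hs]; rfl)
  have h₂ := hX.safe t p .suggest hp (by rw [ht]; rfl)
  rw [hs] at h₁
  rw [ht] at h₂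
  rcases lt_trichotomy s t with h | rfl | h
  · exact absurd ⟨s, h, hs⟩ (h₂.2 x)
  · rw [hs] at ht
    simpa using ht
  · exact absurd ⟨t, h, ht⟩ (h₁.2 y)

lemma exists_suggest (hX : X.IsSlimHBBFT) (hp : X.Honest p) (h : X.Holds t p x) :
    ∃ y, X.Occurs (.send p (.suggest y)) := by
  -- Fairness yields some event of the same task, not this very message, and needs the task still
  -- undone; assuming that it is never done keeps it enabled.
  by_contra! hcon
  obtain ⟨s, -, hs⟩ := hX.fair t p .suggest (.send p (.suggest x)) hp rfl
    ⟨h, fun y hy => hcon y hy.occurs⟩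
  obtain ⟨y, hy⟩ := Event.eq_of_task_suggest hs
  exact hcon y ⟨s, hy⟩

lemma forall_exists_suggest (hX : X.IsSlimHBBFT) (hC : X.IsCommittee C) (hp : X.Honest p)
    (h : X.Holds t p x) (hq : X.Honest q) : ∃ y, X.Occurs (.send q (.suggest y)) := by
  obtain ⟨y, s, hs⟩ := hX.exists_suggest hp h
  have hy := hX.holds_of_suggest hp hs
  obtain ⟨u, hu⟩ := hX.exists_holds_of_send hC hp hq ⟨s, hs⟩ hy.1 (hC.mem hp hy.2.1)
  exact hX.exists_suggest hq hu

lemma exists_enoughSuggestions (hX : X.IsSlimHBBFT) (hC : X.IsCommittee C)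
    (hsug : ∀ q, X.Honest q → ∃ y, X.Occurs (.send q (.suggest y))) (hp : X.Honest p) :
    ∃ t, X.EnoughSuggestions t p := by
  obtain ⟨t, ht⟩ := exists_time_forall X.byzᶜ
    (R := fun t q => ∃ x, X.verify x ∧ X.Selected t p x.owner ∧
      X.Before t (.receive p q (.suggest x)))
    (fun q t u htu ⟨x, hv, hsel, hr⟩ => ⟨x, hv, hsel.mono htu, hr.mono htu⟩) (by
      intro q hq
      have hq := Finset.mem_compl.1 hq
      obtain ⟨y, s, hs⟩ := hsug q hq
      have hy := hX.holds_of_suggest hq hs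
      obtain ⟨u, -, hu⟩ := hX.reliable s p q _ hp hq hs
      obtain ⟨w, hw⟩ := hC.exists_selected hp (hC.mem hq hy.2.1)
      exact ⟨max w (u + 1), y, hy.1, hw.mono (le_max_left _ _), u, by omega, hu⟩)
  exact ⟨t, X.byzᶜ, hX.le_card_honest, ht⟩

/-- Once enough suggestions have arrived, the guards for `1` and for `0` are complementary, so an
undecided voter is never blocked. -/
lemma exists_vote (hX : X.IsSlimHBBFT) (hC : X.IsCommittee C)
    (hsug : ∀ q, X.Honest q → ∃ y, X.Occurs (.send q (.suggest y))) (hp : X.Honest p)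
    (hj : j ∈ C) : ∃ b, X.Occurs (.abaInput p j b) := by
  by_contra! hcon
  obtain ⟨t, ht⟩ := hX.exists_enoughSuggestions hC hsug hp
  obtain ⟨u, hu⟩ := hC.exists_selected hp hj
  have hno : ∀ t b, ¬ X.Before t (.abaInput p j b) := fun t b h => hcon b h.occurs
  have key : ∃ b, X.Enabled (max t u) (.abaInput p j b) := by
    by_cases h : ∃ x, X.Holds (max t u) p x ∧ x.owner = j
    · exact ⟨true, h, hno _⟩
    · exact ⟨false, hu.mono (le_max_right _ _), ht.mono (le_max_left _ _), h, hno _⟩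
  obtain ⟨b, hb⟩ := key
  obtain ⟨s, -, hs⟩ := hX.fair _ p (.vote j) (.abaInput p j b) hp rfl hb
  obtain ⟨c, hc⟩ := Event.eq_of_task_vote hs
  exact hcon c ⟨s, hc⟩

lemma enabled_vote (hX : X.IsSlimHBBFT) (hp : X.Honest p) {b : Bool}
    (h : X.event t = .abaInput p j b) : X.Enabled t (.abaInput p j b) := by
  have := hX.safe t p (.vote j) hp (by rw [h]; rfl)
  rwa [h] at this

/-- Even a vote `0` needs suggestions, and each valid suggestion carries a proposal that is thereby
held. -/
lemma exists_holds_of_vote (hX : X.IsSlimHBBFT) (hp : X.Honest p) {b : Bool}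
    (h : X.event t = .abaInput p j b) : ∃ x, X.Holds t p x := by
  have hen := hX.enabled_vote hp h
  cases b
  · obtain ⟨-, ⟨Q, hQ, hr⟩, -⟩ := hen
    obtain ⟨q, hq⟩ := Finset.card_pos.1 (by omega : 0 < Q.card)
    obtain ⟨x, hv, hsel, hrec⟩ := hr q hq
    exact ⟨x, hv, hsel, q, _, hrec, rfl⟩
  · obtain ⟨⟨x, hx, -⟩, -⟩ := hen
    exact ⟨x, hx⟩

/-- An honest party rejects the owners of the suggestions of at most `f` honest parties. -/
lemma card_rejected_le (hX : X.IsSlimHBBFT) {y : Party f → Proposal f V S}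
    (hy : ∀ q, X.Honest q → X.Occurs (.send q (.suggest (y q)))) (hp : X.Honest p)
    {A : Finset (Party f)}
    (hA : ∀ q ∈ A, X.Honest q ∧ X.Occurs (.abaInput p (y q).owner false)) : A.card ≤ f := by
  classical
  rcases A.eq_empty_or_nonempty with rfl | ⟨q₀, hq₀⟩
  · simp
  have hex : ∃ t j, X.event t = .abaInput p j false :=
    let ⟨t, ht⟩ := (hA q₀ hq₀).2
    ⟨t, _, ht⟩
  obtain ⟨j, hj⟩ := Nat.find_spec hex
  -- The earliest vote `0` of `p`, in any instance: what `p` holds then blocks all its later votes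
  -- `0` for those owners.
  have hmin : ∀ t j, X.event t = .abaInput p j false → Nat.find hex ≤ t := fun t j h =>
    Nat.find_min' hex ⟨j, h⟩
  generalize Nat.find hex = t₀ at hj hmin
  obtain ⟨-, ⟨Q, hQ, hr⟩, -⟩ := hX.enabled_vote hp hj
  -- `Q` has at least `2f+1` of the `3f+1` parties, so its complement has at most `f`.
  have hdisj : A ⊆ Qᶜ := by
    intro q hq
    rw [Finset.mem_compl]
    intro hqQ
    obtain ⟨hqh, t, ht⟩ := hA q hq
    obtain ⟨x, hv, hsel, hrec⟩ := hr q hqQ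
    obtain ⟨u, hu, hue⟩ := id hrec
    obtain rfl : x = y q := hX.suggest_unique hqh
      (hX.authentic u p q _ hp hqh hue).occurs (hy q hqh)
    obtain ⟨-, -, hnot, -⟩ := hX.enabled_vote hp ht
    have hh : X.Holds t₀ p (y q) := ⟨hv, hsel, q, _, hrec, rfl⟩
    exact hnot ⟨y q, hh.mono (hmin t _ ht), rfl⟩
  have := Finset.card_le_card hdisj
  rw [Finset.card_compl, Fintype.card_fin] at this
  omega

/-! ### Decisions, an accepted member, and termination -/

lemma exists_abaOutput (hX : X.IsSlimHBBFT) (hC : X.IsCommittee C) (hA : ∀ j, X.ABAGood j)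
    (hsug : ∀ q, X.Honest q → ∃ y, X.Occurs (.send q (.suggest y))) (hp : X.Honest p)
    (hj : j ∈ C) : ∃ b, X.Occurs (.abaOutput p j b) :=
  (hA j).termination (fun _ hq => hX.exists_vote hC hsug hq hj) p hp

lemma exists_accepted (hX : X.IsSlimHBBFT) (hC : X.IsCommittee C) (hA : ∀ j, X.ABAGood j)
    (hsug : ∀ q, X.Honest q → ∃ y, X.Occurs (.send q (.suggest y))) :
    ∃ j ∈ C, ∀ p b, X.Honest p → X.Occurs (.abaOutput p j b) → b = true := by
  classical
  have hcard := hX.le_card_honest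
  obtain ⟨q₀, hq₀⟩ : X.byzᶜ.Nonempty := Finset.card_pos.1 (by omega)
  -- `V` and `S` are not assumed inhabited, so Byzantine parties get the suggestion of the honest
  -- `q₀` as a dummy value.
  have : ∀ q, ∃ y, X.Honest q → X.Occurs (.send q (.suggest y)) := fun q => by
    by_cases hq : X.Honest q
    · exact (hsug q hq).imp fun _ h _ => h
    · exact (hsug q₀ (Finset.mem_compl.1 hq₀)).imp fun _ _ h => absurd h hq
  choose y hy using this
  obtain ⟨q, hq, hle⟩ := exists_card_preimage_le X.byzᶜ ⟨q₀, hq₀⟩ f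
    (fun p q => X.Occurs (.abaInput p (y q).owner false)) fun p hp =>
      hX.card_rejected_le hy (Finset.mem_compl.1 hp) fun q hq => by
        rw [Finset.mem_filter, Finset.mem_compl] at hq
        exact hq
  have hq := Finset.mem_compl.1 hq
  obtain ⟨s, hs⟩ := hy q hq
  have hmem : (y q).owner ∈ C := hC.mem hq (hX.holds_of_suggest hq hs).2.1
  refine ⟨_, hmem, (hA _).bias
    (X.byzᶜ.filter fun p => ¬ X.Occurs (.abaInput p (y q).owner false)) ?_ ?_⟩
  · have := Finset.card_filter_add_card_filter_not (s := X.byzᶜ)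
      (fun p => X.Occurs (.abaInput p (y q).owner false))
    omega
  · intro p hp
    rw [Finset.mem_filter, Finset.mem_compl] at hp
    refine ⟨hp.1, ?_⟩
    obtain ⟨b, hb⟩ := hX.exists_vote hC hsug hp.1 hmem
    cases b
    · exact absurd hb hp.2
    · exact hb

lemma exists_decided (hX : X.IsSlimHBBFT) (hC : X.IsCommittee C) (hA : ∀ j, X.ABAGood j)
    (hsug : ∀ q, X.Honest q → ∃ y, X.Occurs (.send q (.suggest y))) (hp : X.Honest p) :
    ∃ t, X.Decided t p := by
  obtain ⟨t, ht⟩ := exists_time_forall C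
    (R := fun t j => ∃ b, X.Before t (.abaOutput p j b))
    (fun j t u htu ⟨b, hb⟩ => ⟨b, hb.mono htu⟩) fun j hj =>
      let ⟨b, hb⟩ := hX.exists_abaOutput hC hA hsug hp hj
      let ⟨t, ht⟩ := hb.exists_before
      ⟨t, b, ht⟩
  obtain ⟨u, hu⟩ := (hC.obtained p hp).exists_before
  exact ⟨max t u, C, hu.mono (le_max_right _ _), fun j hj =>
    let ⟨b, hb⟩ := ht j hj
    ⟨b, hb.mono (le_max_left _ _)⟩⟩

/-- Every honest party eventually holds a proposal of each accepted committee member. -/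
lemma exists_holds_of_accepted (hX : X.IsSlimHBBFT) (hC : X.IsCommittee C)
    (hA : ∀ j, X.ABAGood j)
    (hsug : ∀ q, X.Honest q → ∃ y, X.Occurs (.send q (.suggest y))) (hp : X.Honest p)
    (hj : j ∈ C) (hacc : X.Occurs (.abaOutput p j true)) :
    ∃ t x, X.Holds t p x ∧ x.owner = j := by
  obtain ⟨q, hq, s, hs⟩ := (hA j).validity p true hp hacc
  obtain ⟨⟨x, hx, rfl⟩, -⟩ := hX.enabled_vote hq hs
  -- The revealed `z` may differ from `x`; only its owner matters here.
  have hrev : ∃ z, z.owner = x.owner ∧ X.Occurs (.send q (.reveal z)) := by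
    by_contra! hcon
    obtain ⟨t, ht⟩ := hX.exists_decided hC hA hsug hq
    obtain ⟨b, hb⟩ := hX.exists_abaOutput hC hA hsug hq hj
    obtain rfl := (hA x.owner).agreement q p b true hq hp hb hacc
    obtain ⟨u, hu⟩ := hb.exists_before
    obtain ⟨w, -, hw⟩ := hX.fair (max s (max t u)) q (.reveal x.owner) (.send q (.reveal x)) hq
      rfl ⟨hx.mono (by omega), ht.mono (by omega), hu.mono (by omega),
        fun z hz h => hcon z hz h.occurs⟩
    obtain ⟨z, hz, hzw⟩ := Event.eq_of_task_reveal hw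
    exact hcon z hz ⟨w, hzw⟩
  obtain ⟨z, hz, w, hw⟩ := hrev
  have hen := hX.safe w q (.reveal z.owner) hq (by rw [hw]; rfl)
  rw [hw] at hen
  obtain ⟨u, hu⟩ := hX.exists_holds_of_send hC hq hp ⟨w, hw⟩ hen.1.1
    (show z.owner ∈ C from hz ▸ hj)
  exact ⟨u, z, hu, hz⟩

/-- Once all honest parties suggest a proposal, all of them output. -/
lemma exists_output (hX : X.IsSlimHBBFT) (hC : X.IsCommittee C) (hA : ∀ j, X.ABAGood j)
    (hsug : ∀ q, X.Honest q → ∃ y, X.Occurs (.send q (.suggest y))) (hp : X.Honest p) :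
    ∃ O, X.Occurs (.output p O) := by
  classical
  by_contra! hcon
  obtain ⟨t, ht⟩ := exists_time_forall (C.filter fun j => X.Occurs (.abaOutput p j true))
    (R := fun t j => X.Before t (.abaOutput p j true) ∧ ∃ x, X.Holds t p x ∧ x.owner = j)
    (fun j t u htu ⟨hb, x, hx, hj⟩ => ⟨hb.mono htu, x, hx.mono htu, hj⟩) fun j hj => by
      rw [Finset.mem_filter] at hj
      obtain ⟨t, x, hx, hxj⟩ := hX.exists_holds_of_accepted hC hA hsug hp hj.1 hj.2
      obtain ⟨u, hu⟩ := hj.2.exists_before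
      exact ⟨max t u, hu.mono (le_max_right _ _), x, hx.mono (le_max_left _ _), hxj⟩
  obtain ⟨u, hu⟩ := hX.exists_decided hC hA hsug hp
  have hreq : ∀ j, ∃ o : Option V,
      ((∃ v, o = some v) ↔ X.Selected (max t u) p j ∧
        X.Before (max t u) (.abaOutput p j true)) ∧
      ∀ v, o = some v → ∃ σ, X.Holds (max t u) p ⟨j, v, σ⟩ := by
    intro j
    by_cases hj : X.Selected (max t u) p j ∧ X.Before (max t u) (.abaOutput p j true)
    · obtain ⟨-, ⟨_, v, σ⟩, hx, rfl⟩ := ht j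
        (Finset.mem_filter.2 ⟨hC.mem hp hj.1, hj.2.occurs⟩)
      refine ⟨some v, by simpa using hj, fun w hw => ?_⟩
      obtain rfl : v = w := by simpa using hw
      exact ⟨σ, hx.mono (le_max_left _ _)⟩
    · exact ⟨none, by simpa using hj, by simp⟩
  choose O hO using hreq
  obtain ⟨s, -, hs⟩ := hX.fair (max t u) p .output (.output p O) hp rfl
    ⟨hu.mono (le_max_right _ _), fun j => (hO j).1, fun j => (hO j).2,
      fun O' h => hcon O' h.occurs⟩
  obtain ⟨O', hO'⟩ := Event.eq_of_task_output hs
  exact hcon O' ⟨s, hO'⟩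

/-! ### Outputs and the three properties -/

lemma enabled_output (hX : X.IsSlimHBBFT) (hp : X.Honest p)
    (h : X.event t = .output p O) : X.Enabled t (.output p O) := by
  have := hX.safe t p .output hp (by rw [h]; rfl)
  rwa [h] at this

/-- The committee is nonempty, so an output rests on at least one ABA decision; its bit was input by
an honest party, which held a proposal. -/
lemma forall_exists_suggest_of_output (hX : X.IsSlimHBBFT) (hC : X.IsCommittee C)
    (hA : ∀ j, X.ABAGood j) (hp : X.Honest p) (hO : X.Occurs (.output p O)) :
    ∀ q, X.Honest q → ∃ y, X.Occurs (.send q (.suggest y)) := by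
  obtain ⟨t, ht⟩ := hO
  obtain ⟨j, hj⟩ := Finset.card_pos.1 (by rw [hC.card]; omega : 0 < C.card)
  obtain ⟨-, b, hb⟩ := hC.decided hp (hX.enabled_output hp ht).1 hj
  obtain ⟨r, hr, s, hs⟩ := (hA j).validity p b hp hb.occurs
  obtain ⟨x, hx⟩ := hX.exists_holds_of_vote hr hs
  exact fun q hq => hX.forall_exists_suggest hC hr hx hq

/-- Letting `q` differ from `p` expresses that the accepted set does not depend on the observer. -/
lemma mem_output_iff (hX : X.IsSlimHBBFT) (hC : X.IsCommittee C) (hA : ∀ j, X.ABAGood j)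
    (hp : X.Honest p) (hO : X.Occurs (.output p O)) (hq : X.Honest q) :
    (∃ v, O j = some v) ↔ j ∈ C ∧ X.Occurs (.abaOutput q j true) := by
  have hsug := hX.forall_exists_suggest_of_output hC hA hp hO
  obtain ⟨t, ht⟩ := hO
  have hen := hX.enabled_output hp ht
  rw [hen.2.1 j]
  constructor
  · rintro ⟨hsel, hb⟩
    have hj := hC.mem hp hsel
    obtain ⟨b, hbq⟩ := hX.exists_abaOutput hC hA hsug hq hj
    obtain rfl := (hA j).agreement q p b true hq hp hbq hb.occurs
    exact ⟨hj, hbq⟩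
  · rintro ⟨hj, hbq⟩
    obtain ⟨hsel, b, hb⟩ := hC.decided hp hen.1 hj
    obtain rfl := (hA j).agreement p q b true hp hq hb.occurs hbq
    exact ⟨hsel, hb⟩

lemma output_unique (hX : X.IsSlimHBBFT) (hC : X.IsCommittee C) (hP : ∀ j, X.PPBGood j)
    (hA : ∀ j, X.ABAGood j) (hp : X.Honest p) (hq : X.Honest q) {O' : Party f → Option V}
    (hO : X.Occurs (.output p O)) (hO' : X.Occurs (.output q O')) : O' = O := by
  have hiff : ∀ j, (∃ v, O j = some v) ↔ ∃ v, O' j = some v := fun j =>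
    (hX.mem_output_iff hC hA hp hO hp).trans (hX.mem_output_iff hC hA hq hO' hp).symm
  obtain ⟨s, hs⟩ := hO
  obtain ⟨t, ht⟩ := hO'
  funext j
  cases hv : O j with
  | none =>
    cases hw : O' j with
    | none => rfl
    | some w =>
      obtain ⟨v, hv'⟩ := (hiff j).2 ⟨w, hw⟩
      simp [hv] at hv'
  | some v =>
    obtain ⟨w, hw⟩ := (hiff j).1 ⟨v, hv⟩
    obtain ⟨σ, hvv, -, r, m, hr, hm⟩ := (hX.enabled_output hp hs).2.2.1 j v hv
    obtain ⟨τ, hwv, -, r', m', hr', hm'⟩ := (hX.enabled_output hq ht).2.2.1 j w hw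
    rw [hw, (hP j).uniqueness p r m v σ q r' m' w τ hp hq hr.occurs hm hvv hr'.occurs hm' hwv]

theorem agreement (hX : X.IsSlimHBBFT) (hCS : X.CSGood) (hP : ∀ j, X.PPBGood j)
    (hA : ∀ j, X.ABAGood j) : X.Agreement := by
  intro p O hp hO q hq
  obtain ⟨C, hC⟩ := hX.exists_isCommittee hCS
  have huniq : ∀ O', X.Occurs (.output q O') → O' = O := fun O' hO' =>
    hX.output_unique hC hP hA hp hq hO hO'
  obtain ⟨O', hO'⟩ := hX.exists_output hC hA (hX.forall_exists_suggest_of_output hC hA hp hO) hq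
  exact ⟨huniq O' hO' ▸ hO', huniq⟩

theorem validity (hX : X.IsSlimHBBFT) (hCS : X.CSGood) (hP : ∀ j, X.PPBGood j)
    (hA : ∀ j, X.ABAGood j) : X.Validity := by
  intro p O hp hO
  obtain ⟨C, hC⟩ := hX.exists_isCommittee hCS
  have hsub : {j | ∃ v, O j = some v} ⊆ (C : Set (Party f)) := fun j hj =>
    ((hX.mem_output_iff hC hA hp hO hp).1 hj).1
  refine ⟨C, hC.card, hX.exists_honest_mem hC.card.ge, hC.obtained,
    fun j v hv => hsub ⟨v, hv⟩, ?_, ?_, ?_⟩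
  · have hsug := hX.forall_exists_suggest_of_output hC hA hp hO
    obtain ⟨j, hj, hacc⟩ := hX.exists_accepted hC hA hsug
    obtain ⟨b, hb⟩ := hX.exists_abaOutput hC hA hsug hp hj
    obtain rfl := hacc p b hp hb
    exact (Set.ncard_pos (Set.toFinite _)).2
      ⟨j, (hX.mem_output_iff hC hA hp hO hp).2 ⟨hj, hb⟩⟩
  · have := Set.ncard_le_ncard hsub (Set.toFinite _)
    rwa [Set.ncard_coe_finset, hC.card] at this
  · intro j v hv
    obtain ⟨t, ht⟩ := hO
    obtain ⟨σ, hver, -, r, m, ⟨s, -, hs⟩, hm⟩ := (hX.enabled_output hp ht).2.2.1 j v hv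
    obtain ⟨D, hD, hDj⟩ := (hP j).provability s p r m v σ hp hs hm hver
    refine ⟨⟨σ, hver⟩, ⟨D, hD, fun d hd => ⟨(hDj d hd).1, (hDj d hd).2.occurs⟩⟩, fun hj => ?_⟩
    -- One honest acceptor suffices to trace the request back to the broadcast of `j`, hence to its
    -- input.
    obtain ⟨d, hd⟩ := Finset.card_pos.1 (by omega : 0 < D.card)
    obtain ⟨hdh, u, -, hu⟩ := hDj d hd
    obtain ⟨w, -, hw⟩ := (hP j).authenticity u d v hdh hj hu
    have hen := hX.safe w j .broadcast hj (by rw [hw]; rfl)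
    rw [hw] at hen
    exact hen.1.occurs

/-- An honest committee member with an input eventually sends a proposal with a valid proof. -/
lemma exists_propose (hX : X.IsSlimHBBFT) (hC : X.IsCommittee C) (hP : ∀ j, X.PPBGood j)
    (hj : j ∈ C) (hh : X.Honest j) {v : V} (hv : X.Occurs (.input j v)) :
    ∃ x, x.owner = j ∧ X.verify x ∧ X.Occurs (.send j (.propose x)) := by
  have hbc : ∃ w, X.Occurs (.ppbInput j w) := by
    by_contra! hcon
    obtain ⟨t, ht⟩ := hv.exists_before
    obtain ⟨u, hu⟩ := hC.exists_selected hh hj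
    obtain ⟨s, -, hs⟩ := hX.fair (max t u) j .broadcast (.ppbInput j v) hh rfl
      ⟨ht.mono (le_max_left _ _), hu.mono (le_max_right _ _), fun w h => hcon w h.occurs⟩
    obtain ⟨w, hw⟩ := Event.eq_of_task_broadcast hs
    exact hcon w ⟨s, hw⟩
  obtain ⟨w, hw⟩ := hbc
  obtain ⟨σ, hσ⟩ := (hP j).termination w hh hw fun p hp => hC.exists_selected hp hj
  have hsend : ∃ x, X.Occurs (.send j (.propose x)) := by
    by_contra! hcon
    obtain ⟨t, ht⟩ := hw.exists_before
    obtain ⟨u, hu⟩ := hσ.exists_before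
    obtain ⟨s, -, hs⟩ := hX.fair (max t u) j .propose (.send j (.propose ⟨j, w, σ⟩)) hh rfl
      ⟨rfl, ht.mono (le_max_left _ _), hu.mono (le_max_right _ _), fun x h => hcon x h.occurs⟩
    obtain ⟨x, hx⟩ := Event.eq_of_task_propose hs
    exact hcon x ⟨s, hx⟩
  obtain ⟨⟨i, a, τ⟩, s, hs⟩ := hsend
  have hen := hX.safe s j .propose hh (by rw [hs]; rfl)
  rw [hs] at hen
  obtain ⟨rfl, ha, hτ, -⟩ := hen
  exact ⟨_, rfl, (hP _).correctness a τ hh ha.occurs hτ.occurs, s, hs⟩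

theorem totality (hX : X.IsSlimHBBFT) (hCS : X.CSGood) (hP : ∀ j, X.PPBGood j)
    (hA : ∀ j, X.ABAGood j) : X.Totality := by
  intro A hcard hin p hp
  obtain ⟨C, hC⟩ := hX.exists_isCommittee hCS
  obtain ⟨j, hjA, hjC⟩ : ∃ j ∈ A, j ∈ C := by
    by_contra! hcon
    -- Disjointness would require `(2f+1) + (f+1) = 3f+2` parties.
    have h := Finset.card_le_univ (A.disjUnion C (Finset.disjoint_left.2 hcon))
    rw [Finset.card_disjUnion, Fintype.card_fin, hC.card] at h
    omega
  obtain ⟨hj, v, hv⟩ := hin j hjA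
  obtain ⟨x, rfl, hver, hsend⟩ := hX.exists_propose hC hP hjC hj hv
  obtain ⟨t, ht⟩ := hX.exists_holds_of_send hC hj hj hsend hver hjC
  exact hX.exists_output hC hA (fun q hq => hX.forall_exists_suggest hC hj ht hq) hp

end IsSlimHBBFT

end Execution

/-! ### Negligible probabilities -/

lemma Negligible.add {ε δ : ℕ → ℝ} (hε : Negligible ε) (hδ : Negligible δ) :
    Negligible fun k => ε k + δ k :=
  SuperpolynomialDecay.add hε hδ

lemma Negligible.of_le {ε δ : ℕ → ℝ} (hδ : Negligible δ) (h₀ : ∀ k, 0 ≤ ε k)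
    (h : ∀ k, ε k ≤ δ k) : Negligible ε :=
  SuperpolynomialDecay.trans_abs_le hδ fun k => by
    rw [abs_of_nonneg (h₀ k)]
    exact (h k).trans (le_abs_self _)

/-- A union bound: if each choice of one of polynomially many events has negligible
probability, so does their union. -/
lemma negligible_union {f : ℕ → ℕ} (hf : ∃ c, ∀ k, f k ≤ k ^ c + c)
    {Ω : ℕ → Type*} [∀ k, MeasurableSpace (Ω k)]
    (P : ∀ k, Measure (Ω k)) [∀ k, IsProbabilityMeasure (P k)]
    (B : ∀ k, Party (f k) → Set (Ω k))
    (hB : ∀ j : ∀ k, Party (f k), Negligible fun k => (P k).real (B k (j k))) :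
    Negligible fun k => (P k).real (⋃ j, B k j) := by
  obtain ⟨c, hc⟩ := hf
  have hmax : ∀ k, ∃ j, ∀ i, (P k).real (B k i) ≤ (P k).real (B k j) := fun k =>
    Finite.exists_max fun j => (P k).real (B k j)
  -- The worst party for each `k` is itself an admissible choice in `hB`, so a single negligible
  -- function bounds all the summands.
  choose j hj using hmax
  have hneg : Negligible fun k =>
      ((3 * (Polynomial.X ^ c + Polynomial.C (c : ℝ)) + 1 : Polynomial ℝ).eval (k : ℝ)) *
        (P k).real (B k (j k)) :=
    SuperpolynomialDecay.polynomial_mul (hB j) _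
  refine hneg.of_le (fun k => measureReal_nonneg) fun k => ?_
  calc (P k).real (⋃ j, B k j) ≤ ∑ i, (P k).real (B k i) := measureReal_iUnion_fintype_le _
    _ ≤ ∑ _i : Party (f k), (P k).real (B k (j k)) := Finset.sum_le_sum fun i _ => hj k i
    _ = (3 * f k + 1) * (P k).real (B k (j k)) := by simp
    _ ≤ _ := by
      gcongr
      have : (f k : ℝ) ≤ (k : ℝ) ^ c + c := mod_cast hc k
      simp
      linarith

end SlimHBBFT

theorem mainTheorem1 {V S : Type*}
    (f : ℕ → ℕ) (hf : ∃ c, ∀ k, f k ≤ k ^ c + c)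
    {Ω : ℕ → Type*} [∀ k, MeasurableSpace (Ω k)]
    (P : ∀ k, Measure (Ω k)) [∀ k, IsProbabilityMeasure (P k)]
    (X : ∀ k, Ω k → SlimHBBFT.Execution (f k) V S)
    (hX : ∀ k, ∀ᵐ ω ∂(P k), (X k ω).IsSlimHBBFT)
    (hCS : SlimHBBFT.Negligible fun k => (P k).real {ω | ¬ (X k ω).CSGood})
    (hPPB : ∀ j : ∀ k, SlimHBBFT.Party (f k),
      SlimHBBFT.Negligible fun k => (P k).real {ω | ¬ (X k ω).PPBGood (j k)})
    (hABA : ∀ j : ∀ k, SlimHBBFT.Party (f k),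
      SlimHBBFT.Negligible fun k => (P k).real {ω | ¬ (X k ω).ABAGood (j k)}) :
    SlimHBBFT.Negligible fun k => (P k).real
      {ω | ¬ ((X k ω).Agreement ∧ (X k ω).Validity ∧ (X k ω).Totality)} := by
  have hneg := (hCS.add (SlimHBBFT.negligible_union hf P
    (fun k j => {ω | ¬ (X k ω).PPBGood j}) hPPB)).add
    (SlimHBBFT.negligible_union hf P (fun k j => {ω | ¬ (X k ω).ABAGood j}) hABA)
  refine hneg.of_le (fun k => measureReal_nonneg) fun k => ?_
  refine le_trans ?_ ((measureReal_union_le _ _).trans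
    (add_le_add_left (measureReal_union_le _ _) _))
  -- The inclusion of bad events holds only almost everywhere, since executions follow the protocol
  -- only almost surely.
  refine ENNReal.toReal_mono (measure_ne_top _ _) (measure_mono_ae ?_)
  filter_upwards [hX k] with ω hω hbad
  by_contra hcon
  change ω ∉ (_ ∪ _ ∪ _ : Set (Ω k)) at hcon
  simp only [Set.mem_union, Set.mem_iUnion, Set.mem_ofPred_eq, not_or, not_exists,
    not_not] at hcon
  obtain ⟨⟨hcs, hppb⟩, haba⟩ := hcon
  exact hbad ⟨hω.agreement hcs hppb haba, hω.validity hcs hppb haba,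
    hω.totality hcs hppb haba⟩
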